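/- Let $G\subset \mathrm{GL}_n(\mathbb R)$ be a closed subgroup with Lie algebra $\mathfrak g\subset\mathfrak{gl}_n(\mathbb R)$. A *$G$-structure with connection* $(P,\theta,\omega)$ consists of a (Hausdorff, second countable) smooth manifold $P$ of dimension $n+\dim G$ with a smooth right action of $G$ that is proper, locally free and effective, together with (a) a pointwise surjective 1-form $\theta\in\Omega^1(P,\mathbb R^n)$ with $\theta(\tilde\alpha)=0$ for all $\alpha\in\mathfrak g$ and $g^*\theta=g^{-1}\cdot\theta$ for all $g\in G$, and (b) a 1-form $\omega\in\Omega^1(P,\mathfrak g)$ with $\omega(\tilde\alpha)=\alpha$ for all $\alpha\in\mathfrak g$ and $g^*\omega=\mathrm{Ad}_{g^{-1}}\circ\omega$ for all $g\in G$, where $\tilde\alpha_p=\frac{d}{dt}\big|_{t=0}\,p\cdot\exp(t\alpha)$. A *local equivalence* is a $G$-equivariant diffeomorphism $\Phi:U\to V$ between $G$-saturated open subsets of $P$ with $\Phi^*\theta=\theta$ and $\Phi^*\omega=\omega$. A smooth function $I:P\to\mathbb R$ is *invariant* if $I\circ\Phi=I|_U$ for every local equivalence $\Phi:U\to V$. We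 call $(P,\theta,\omega)$ *fully regular* if the dimension of $\{d_pI : I \text{ an invariant function}\}\subset T_p^*P$ does not depend on $p\in P$, and *locally homogeneous* if for any $m_1,m_2\in P/G$ there is a local equivalence whose induced map between open subsets of $P/G$ sends $m_1$ to $m_2$. Write $p\sim q$ if $\Phi(p)=q$ for some local equivalence $\Phi$ defined near $p$. The *classifying space* (called the classifying manifold in the fully regular case) is the quotient $X_{(\theta,\omega)}=P/{\sim}$, with the right $G$-action $[p]\,g=[pg]$. **Theorem.** A $G$-structure with connection $(P,\theta,\omega)$ is locally homogeneous if and only if it is fully regular and the $G$-action on $X_{(\theta,\omega)}$ is transitive. -/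

import Mathlib

open Filter Topology
open scoped Manifold ContDiff

section LieProduct

theorem norm_nexp_le {A : Type*} [NormedRing A] [NormOneClass A] [NormedAlgebra ℝ A] [CompleteSpace A]
    (x : A) : ‖NormedSpace.exp x‖ ≤ Real.exp ‖x‖ := by
  have h := NormedSpace.exp_series_hasSum_exp' (𝕂 := ℝ) x
  have h2 := NormedSpace.exp_series_hasSum_exp' (𝕂 := ℝ) (‖x‖)
  rw [← Real.exp_eq_exp_ℝ] at h2
  rw [← h.tsum_eq]
  refine tsum_of_norm_bounded h2 fun n => ?_
  rw [norm_smul, norm_inv, Real.norm_natCast, smul_eq_mul]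
  gcongr
  exact norm_pow_le x n

theorem norm_pow_sub_pow_le {A : Type*} [NormedRing A] [NormOneClass A]
    (x y : A) (m : ℝ) (hm : 1 ≤ m) (hx : ‖x‖ ≤ m) (hy : ‖y‖ ≤ m)
    (k : ℕ) :
    ‖x ^ k - y ^ k‖ ≤ k * m ^ k * ‖x - y‖ := by
  induction k with
  | zero => simp
  | succ k ih =>
    have e : x ^ (k+1) - y ^ (k+1) = x ^ k * (x - y) + (x ^ k - y ^ k) * y := by
      rw [pow_succ, pow_succ]; noncomm_ring
    have h1 : ‖x ^ k‖ ≤ m ^ k := (norm_pow_le x k).trans (by gcongr)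
    have hmk : m ^ k ≤ m ^ (k+1) := pow_le_pow_right₀ hm (Nat.le_succ k)
    calc _ = ‖x ^ k * (x - y) + (x ^ k - y ^ k) * y‖ := by rw [e]
      _ ≤ ‖x ^ k‖ * ‖x - y‖ + ‖x ^ k - y ^ k‖ * ‖y‖ :=
        (norm_add_le _ _).trans (add_le_add (norm_mul_le _ _) (norm_mul_le _ _))
      _ ≤ m ^ (k+1) * ‖x - y‖ + (k * m ^ k * ‖x - y‖) * m := by
        gcongr
        exact h1.trans hmk
      _ = _ := by push_cast; ring

/-- The Lie product formula. -/
theorem lie_product {A : Type*} [NormedRing A] [NormOneClass A] [NormedAlgebra ℝ A] [CompleteSpace A]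
    (a b : A) :
    Tendsto (fun k : ℕ => (NormedSpace.exp ((k:ℝ)⁻¹ • a) * NormedSpace.exp ((k:ℝ)⁻¹ • b)) ^ k)
      atTop (𝓝 (NormedSpace.exp (a + b))) := by
  have hd : HasDerivAt (fun s : ℝ => NormedSpace.exp (s • a) * NormedSpace.exp (s • b)
      - NormedSpace.exp (s • (a + b))) 0 0 := by
    have ha := hasDerivAt_exp_smul_const (𝕂 := ℝ) a (0:ℝ)
    have hb := hasDerivAt_exp_smul_const (𝕂 := ℝ) b (0:ℝ)
    have hc := hasDerivAt_exp_smul_const (𝕂 := ℝ) (a + b) (0:ℝ)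
    have hd := (ha.mul hb).sub hc
    simp only [zero_smul, NormedSpace.exp_zero, one_mul, mul_one, sub_self] at hd
    exact hd
  have ho := hd.isLittleO
  simp only [sub_zero, zero_smul, NormedSpace.exp_zero, mul_one, sub_self, smul_zero] at ho
  have hk : Tendsto (fun k : ℕ => ((k:ℝ))⁻¹) atTop (𝓝 0) := tendsto_inv_atTop_nhds_zero_nat
  have ho2 := (ho.comp_tendsto hk).norm_left
  rw [tendsto_iff_norm_sub_tendsto_zero]
  have ht : Tendsto (fun k : ℕ => Real.exp (‖a‖ + ‖b‖) *
      (‖NormedSpace.exp ((k:ℝ)⁻¹ • a) * NormedSpace.exp ((k:ℝ)⁻¹ • b)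
        - NormedSpace.exp ((k:ℝ)⁻¹ • (a + b))‖ / (k:ℝ)⁻¹)) atTop (𝓝 0) := by
    simpa using (ho2.tendsto_div_nhds_zero).const_mul (Real.exp (‖a‖ + ‖b‖))
  refine squeeze_zero' (Eventually.of_forall fun _ => norm_nonneg _) ?_ ht
  filter_upwards [eventually_gt_atTop 0] with k hk0
  have hk' : (0:ℝ) < k := by exact_mod_cast hk0
  have hpow : NormedSpace.exp (a + b) = NormedSpace.exp ((k:ℝ)⁻¹ • (a + b)) ^ k := by
    let : NormedAlgebra ℚ A := NormedAlgebra.restrictScalars ℚ ℝ A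
    have := NormedSpace.exp_nsmul k ((k:ℝ)⁻¹ • (a + b))
    rw [← this, ← Nat.cast_smul_eq_nsmul ℝ, smul_smul, mul_inv_cancel₀ hk'.ne', one_smul]
  have hm : Real.exp ((k:ℝ)⁻¹ * (‖a‖ + ‖b‖)) ^ k = Real.exp (‖a‖ + ‖b‖) := by
    rw [← Real.exp_nat_mul, ← mul_assoc, mul_inv_cancel₀ hk'.ne', one_mul]
  have hn (c : A) : ‖(k:ℝ)⁻¹ • c‖ = (k:ℝ)⁻¹ * ‖c‖ := by
    rw [norm_smul, norm_inv, Real.norm_natCast]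
  rw [hpow]
  refine (norm_pow_sub_pow_le _ _ (Real.exp ((k:ℝ)⁻¹ * (‖a‖ + ‖b‖))) ?_ ?_ ?_ k).trans ?_
  · rw [Real.one_le_exp_iff]; positivity
  · refine (norm_mul_le _ _).trans ((mul_le_mul (norm_nexp_le _) (norm_nexp_le _)
      (norm_nonneg _) (Real.exp_pos _).le).trans ?_)
    rw [← Real.exp_add, hn, hn, mul_add]
  · refine (norm_nexp_le _).trans ?_
    rw [hn]
    gcongr
    exact norm_add_le _ _
  · rw [hm]
    apply le_of_eq
    field_simp
end LieProduct

section LieAlgebra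

open scoped Matrix.Norms.Operator
/-- The matrix exponential with values in `GLₙ(ℝ)`. -/
noncomputable def expGL {n : ℕ} (A : Matrix (Fin n) (Fin n) ℝ) : GL (Fin n) ℝ :=
  (Matrix.isUnit_exp A).unit

theorem val_expGL {n : ℕ} (A : Matrix (Fin n) (Fin n) ℝ) :
    (expGL A : Matrix (Fin n) (Fin n) ℝ) = NormedSpace.exp A := rfl

/-- The Lie algebra `𝔤 = {A | exp (t A) ∈ G for all t}` of a closed subgroup `G ⊆ GLₙ(ℝ)`, as a
linear subspace of the `n × n` matrices. -/
noncomputable def lieAlgSubmodule {n : ℕ} (G : ClosedSubgroup (GL (Fin n) ℝ)) :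
    Submodule ℝ (Matrix (Fin n) (Fin n) ℝ) where
  carrier := {A | ∀ t : ℝ, expGL (t • A) ∈ G}
  zero_mem' t := by
    have : expGL (t • (0 : Matrix (Fin n) (Fin n) ℝ)) = 1 := Units.ext (by simp [val_expGL])
    rw [this]; exact one_mem G
  smul_mem' c A hA t := by
    rw [smul_smul]; exact hA _
  add_mem' {A B} hA hB t := by
    rcases Nat.eq_zero_or_pos n with rfl | hn
    · have : expGL (t • (A + B)) = 1 := Subsingleton.elim _ _
      rw [this]; exact one_mem G
    have : Nonempty (Fin n) := ⟨⟨0, hn⟩⟩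
    have h (X Y : Matrix (Fin n) (Fin n) ℝ) :
        Tendsto (fun k : ℕ => (expGL ((k:ℝ)⁻¹ • X) * expGL ((k:ℝ)⁻¹ • Y)) ^ k) atTop
          (𝓝 (expGL (X + Y))) := by
      have he := (Units.isOpenEmbedding_val (R := Matrix (Fin n) (Fin n) ℝ)).isEmbedding
      exact he.tendsto_nhds_iff.mpr (lie_product X Y)
    have h' := h (t • A) (t • B)
    rw [← smul_add] at h'
    refine G.isClosed'.mem_of_tendsto h' (Eventually.of_forall fun k => ?_)
    refine G.toSubgroup.pow_mem (G.toSubgroup.mul_mem ?_ ?_) k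
    · rw [smul_smul]; exact hA _
    · rw [smul_smul]; exact hB _

end LieAlgebra

section GStructures

open scoped RightActions Matrix.Norms.Operator

variable {n : ℕ} (G : ClosedSubgroup (GL (Fin n) ℝ))

/-- The Lie algebra `𝔤` as a normed space. Only its finite-dimensional topology and smooth
structure matter, so the choice of norm is irrelevant. -/
def LieAlg : Type := lieAlgSubmodule G

noncomputable instance : NormedAddCommGroup (LieAlg G) :=
  inferInstanceAs (NormedAddCommGroup (lieAlgSubmodule G))

noncomputable instance : NormedSpace ℝ (LieAlg G) :=
  inferInstanceAs (NormedSpace ℝ (lieAlgSubmodule G))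

instance : FiniteDimensional ℝ (LieAlg G) :=
  inferInstanceAs (FiniteDimensional ℝ (lieAlgSubmodule G))

variable {G} in
/-- The inclusion `𝔤 ⊆ 𝔤𝔩ₙ(ℝ)`. -/
def LieAlg.toMatrix (α : LieAlg G) : Matrix (Fin n) (Fin n) ℝ := α.1

/-- The exponential map `𝔤 → G`. -/
noncomputable def expG (α : LieAlg G) : G :=
  ⟨expGL α.1, by simpa using α.2 1⟩

variable {E : Type*} [NormedAddCommGroup E] [NormedSpace ℝ E]
  {P : Type*} [TopologicalSpace P] [ChartedSpace E P]

/-- The infinitesimal generator `α̃_p = d/dt|_{t=0} p · exp (t α)` of the right `G`-action. -/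
noncomputable def infGenerator [MulAction (G)ᵐᵒᵖ P] (α : LieAlg G) (p : P) :
    TangentSpace 𝓘(ℝ, E) p :=
  mfderiv 𝓘(ℝ, ℝ) 𝓘(ℝ, E) (fun t : ℝ => p <• expG G (t • α)) 0 (1 : ℝ)

variable (E P) in
/-- A `G`-structure with connection `(P, θ, ω)`: a smooth, proper, effective and locally free right
action of `G` on a manifold `P` of dimension `n + dim G`, a tensorial, pointwise surjective 1-form
`θ ∈ Ω¹(P, ℝⁿ)` and a connection 1-form `ω ∈ Ω¹(P, 𝔤)`. A right action of `G` is an action of the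
opposite group, with `p <• g` for `p · g`.

Joint smoothness of `P × G → P` near a point `(p, g)` is expressed in the exponential chart
`α ↦ g exp α` of `G`: since `p · (g exp α) = (p · g) · exp α`, it amounts to the first two fields.
A vector-valued 1-form is smooth iff it is smooth as a function on the tangent bundle. -/
structure GStructureWithConnection [IsManifold 𝓘(ℝ, E) ∞ P] [MulAction (G)ᵐᵒᵖ P] where
  contMDiff_smul : ∀ g : G, ContMDiff 𝓘(ℝ, E) 𝓘(ℝ, E) ∞ (fun p : P => p <• g)
  contMDiff_smul_exp : ContMDiff (𝓘(ℝ, E).prod 𝓘(ℝ, LieAlg G)) 𝓘(ℝ, E) ∞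
    (fun x : P × LieAlg G => x.1 <• expG G x.2)
  proper : ProperSMul (G)ᵐᵒᵖ P
  effective : FaithfulSMul (G)ᵐᵒᵖ P
  locallyFree : ∀ p : P, DiscreteTopology (MulAction.stabilizer (G)ᵐᵒᵖ p)
  dim_eq : Module.finrank ℝ E = n + Module.finrank ℝ (LieAlg G)
  theta : ∀ p : P, TangentSpace 𝓘(ℝ, E) p →L[ℝ] (Fin n → ℝ)
  contMDiff_theta : ContMDiff 𝓘(ℝ, E).tangent 𝓘(ℝ, Fin n → ℝ) ∞
    (fun ξ : TangentBundle 𝓘(ℝ, E) P => theta ξ.proj ξ.2)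
  theta_surjective : ∀ p, Function.Surjective (theta p)
  theta_horizontal : ∀ (α : LieAlg G) (p : P), theta p (infGenerator G α p) = 0
  theta_equivariant : ∀ (g : G) (p : P) (ξ : TangentSpace 𝓘(ℝ, E) p),
    theta (p <• g) (mfderiv 𝓘(ℝ, E) 𝓘(ℝ, E) (fun q : P => q <• g) p ξ) =
      (((g⁻¹ : G) : GL (Fin n) ℝ) : Matrix (Fin n) (Fin n) ℝ).mulVec (theta p ξ)
  omega : ∀ p : P, TangentSpace 𝓘(ℝ, E) p →L[ℝ] LieAlg G
  contMDiff_omega : ContMDiff 𝓘(ℝ, E).tangent 𝓘(ℝ, LieAlg G) ∞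
    (fun ξ : TangentBundle 𝓘(ℝ, E) P => omega ξ.proj ξ.2)
  omega_vertical : ∀ (α : LieAlg G) (p : P), omega p (infGenerator G α p) = α
  omega_equivariant : ∀ (g : G) (p : P) (ξ : TangentSpace 𝓘(ℝ, E) p),
    (omega (p <• g) (mfderiv 𝓘(ℝ, E) 𝓘(ℝ, E) (fun q : P => q <• g) p ξ)).toMatrix =
      (((g⁻¹ : G) : GL (Fin n) ℝ) : Matrix (Fin n) (Fin n) ℝ) *
        (omega p ξ).toMatrix *
        ((g : GL (Fin n) ℝ) : Matrix (Fin n) (Fin n) ℝ)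

/-- `Φ^* β = β` on the domain of the partially defined diffeomorphism `Φ`, for a vector-valued
1-form `β`. -/
def PreservesForm {F : Type*} [TopologicalSpace F] [AddCommGroup F] [Module ℝ F]
    (β : ∀ p : P, TangentSpace 𝓘(ℝ, E) p →L[ℝ] F)
    (Φ : PartialDiffeomorph 𝓘(ℝ, E) 𝓘(ℝ, E) P P ∞) : Prop :=
  ∀ p ∈ Φ.source, ∀ ξ : TangentSpace 𝓘(ℝ, E) p,
    β (Φ p) (mfderiv 𝓘(ℝ, E) 𝓘(ℝ, E) Φ p ξ) = β p ξ

variable {F : Type*} [TopologicalSpace F] [AddCommGroup F] [Module ℝ F]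

theorem PreservesForm.symm {β : ∀ p : P, TangentSpace 𝓘(ℝ, E) p →L[ℝ] F}
    {Φ : PartialDiffeomorph 𝓘(ℝ, E) 𝓘(ℝ, E) P P ∞} (h : PreservesForm β Φ) :
    PreservesForm β Φ.symm := by
  intro q hq ξ
  have hp : Φ.symm q ∈ Φ.source := Φ.map_target hq
  have hr : Φ (Φ.symm q) = q := Φ.right_inv hq
  have h1 := h (Φ.symm q) hp (mfderiv 𝓘(ℝ, E) 𝓘(ℝ, E) Φ.symm q ξ)
  have hc : mfderiv 𝓘(ℝ, E) 𝓘(ℝ, E) (Φ ∘ Φ.symm) q =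
      (mfderiv 𝓘(ℝ, E) 𝓘(ℝ, E) Φ (Φ.symm q)).comp (mfderiv 𝓘(ℝ, E) 𝓘(ℝ, E) Φ.symm q) :=
    mfderiv_comp q (Φ.mdifferentiableAt (by simp) hp) (Φ.symm.mdifferentiableAt (by simp) hq)
  have hi : mfderiv 𝓘(ℝ, E) 𝓘(ℝ, E) (Φ ∘ Φ.symm) q = ContinuousLinearMap.id ℝ E := by
    have he : (Φ ∘ Φ.symm : P → P) =ᶠ[𝓝 q] id :=
      Filter.eventually_of_mem (Φ.open_target.mem_nhds hq) fun x hx => Φ.right_inv hx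
    exact he.mfderiv_eq.trans mfderiv_id
  have hv : mfderiv 𝓘(ℝ, E) 𝓘(ℝ, E) Φ (Φ.symm q)
      (mfderiv 𝓘(ℝ, E) 𝓘(ℝ, E) Φ.symm q ξ) = ξ := by
    have := congrArg (fun L : E →L[ℝ] E => L ξ) (hc.symm.trans hi)
    exact this
  rw [← h1]
  exact (congrArg (β (Φ (Φ.symm q))) hv).trans (congrArg (fun x => (β x : E →L[ℝ] F) ξ) hr)

theorem PreservesForm.trans {β : ∀ p : P, TangentSpace 𝓘(ℝ, E) p →L[ℝ] F}
    {Φ Ψ : PartialDiffeomorph 𝓘(ℝ, E) 𝓘(ℝ, E) P P ∞} (h : PreservesForm β Φ)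
    (h' : PreservesForm β Ψ) : PreservesForm β (Φ.trans Ψ) := by
  rintro p ⟨hp, hp'⟩ ξ
  have hc : mfderiv 𝓘(ℝ, E) 𝓘(ℝ, E) (Ψ ∘ Φ) p =
      (mfderiv 𝓘(ℝ, E) 𝓘(ℝ, E) Ψ (Φ p)).comp (mfderiv 𝓘(ℝ, E) 𝓘(ℝ, E) Φ p) :=
    mfderiv_comp p (Ψ.mdifferentiableAt (by simp) hp') (Φ.mdifferentiableAt (by simp) hp)
  change β (Ψ (Φ p)) (mfderiv 𝓘(ℝ, E) 𝓘(ℝ, E) (Ψ ∘ Φ) p ξ) = β p ξ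
  rw [hc]
  exact (h' (Φ p) hp' _).trans (h p hp ξ)

namespace GStructureWithConnection

variable {G} [IsManifold 𝓘(ℝ, E) ∞ P] [MulAction (G)ᵐᵒᵖ P] (S : GStructureWithConnection G E P)

/-- Local (self-)equivalences: `G`-equivariant diffeomorphisms between `G`-saturated open subsets
of `P` that preserve both `θ` and `ω`. -/
structure IsLocalEquivalence (Φ : PartialDiffeomorph 𝓘(ℝ, E) 𝓘(ℝ, E) P P ∞) : Prop where
  source_saturated : ∀ p ∈ Φ.source, ∀ g : G, p <• g ∈ Φ.source
  target_saturated : ∀ p ∈ Φ.target, ∀ g : G, p <• g ∈ Φ.target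
  equivariant : ∀ p ∈ Φ.source, ∀ g : G, Φ (p <• g) = Φ p <• g
  preserves_theta : PreservesForm S.theta Φ
  preserves_omega : PreservesForm S.omega Φ

variable {S} in
theorem IsLocalEquivalence.symm {Φ : PartialDiffeomorph 𝓘(ℝ, E) 𝓘(ℝ, E) P P ∞}
    (h : S.IsLocalEquivalence Φ) : S.IsLocalEquivalence Φ.symm where
  source_saturated := h.target_saturated
  target_saturated := h.source_saturated
  equivariant q hq g := by
    have hp : Φ.symm q ∈ Φ.source := Φ.map_target hq
    have hr : Φ (Φ.symm q) = q := Φ.right_inv hq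
    have e := h.equivariant _ hp g
    rw [hr] at e
    rw [← e]
    exact Φ.left_inv (h.source_saturated _ hp g)
  preserves_theta := h.preserves_theta.symm
  preserves_omega := h.preserves_omega.symm

variable {S} in
theorem IsLocalEquivalence.trans {Φ Ψ : PartialDiffeomorph 𝓘(ℝ, E) 𝓘(ℝ, E) P P ∞}
    (h : S.IsLocalEquivalence Φ) (h' : S.IsLocalEquivalence Ψ) :
    S.IsLocalEquivalence (Φ.trans Ψ) where
  source_saturated := by
    rintro p ⟨hp, hp'⟩ g
    refine ⟨h.source_saturated p hp g, ?_⟩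
    have e := h.equivariant p hp g
    change Φ (p <• g) ∈ Ψ.source
    rw [e]
    exact h'.source_saturated _ hp' g
  target_saturated := by
    rintro p ⟨hp, hp'⟩ g
    refine ⟨h'.target_saturated p hp g, ?_⟩
    have e := h'.symm.equivariant p hp g
    change Ψ.symm (p <• g) ∈ Φ.target
    rw [e]
    exact h.target_saturated _ hp' g
  equivariant := by
    rintro p ⟨hp, hp'⟩ g
    change Ψ (Φ (p <• g)) = Ψ (Φ p) <• g
    rw [h.equivariant p hp g]
    exact h'.equivariant _ hp' g
  preserves_theta := h.preserves_theta.trans h'.preserves_theta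
  preserves_omega := h.preserves_omega.trans h'.preserves_omega

theorem isLocalEquivalence_refl :
    S.IsLocalEquivalence (Diffeomorph.refl 𝓘(ℝ, E) P ∞).toPartialDiffeomorph where
  source_saturated _ _ _ := Set.mem_univ _
  target_saturated _ _ _ := Set.mem_univ _
  equivariant _ _ _ := rfl
  preserves_theta p _ ξ := congrArg (S.theta p) (congrArg (fun L : E →L[ℝ] E => L ξ) mfderiv_id)
  preserves_omega p _ ξ := congrArg (S.omega p) (congrArg (fun L : E →L[ℝ] E => L ξ) mfderiv_id)

/-- The invariant functions `Inv(P, θ, ω)`: smooth real functions `I` with `Φ^* I = I` for every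
local equivalence `Φ`. -/
def invariantFunctions : Submodule ℝ (P → ℝ) where
  carrier := {f | ContMDiff 𝓘(ℝ, E) 𝓘(ℝ, ℝ) ∞ f ∧
    ∀ Φ, S.IsLocalEquivalence Φ → ∀ p ∈ Φ.source, f (Φ p) = f p}
  zero_mem' := ⟨contMDiff_const, fun _ _ _ _ => rfl⟩
  add_mem' hf hg := ⟨hf.1.add hg.1, fun Φ h p hp =>
    congrArg₂ (· + ·) (hf.2 Φ h p hp) (hg.2 Φ h p hp)⟩
  smul_mem' c _ hf := ⟨(contMDiff_const (c := c)).mul hf.1, fun Φ h p hp =>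
    congrArg (c • ·) (hf.2 Φ h p hp)⟩

/-- The subspace `𝓘_p = {d_p I : I ∈ Inv(P, θ, ω)}` of the cotangent space `T_p^* P`. -/
noncomputable def invariantDifferentials (p : P) :
    Submodule ℝ (TangentSpace 𝓘(ℝ, E) p →L[ℝ] ℝ) where
  carrier := {l | ∃ f ∈ S.invariantFunctions, l = mfderiv 𝓘(ℝ, E) 𝓘(ℝ, ℝ) f p}
  zero_mem' := ⟨0, Submodule.zero_mem _, by
    exact (mfderiv_const (I := 𝓘(ℝ, E)) (I' := 𝓘(ℝ, ℝ)) (c := (0 : ℝ)) (x := p)).symm⟩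
  add_mem' := by
    rintro _ _ ⟨f, hf, rfl⟩ ⟨g, hg, rfl⟩
    exact ⟨f + g, Submodule.add_mem _ hf hg, (mfderiv_add
      (hf.1.mdifferentiable (by simp) p) (hg.1.mdifferentiable (by simp) p)).symm⟩
  smul_mem' := by
    rintro c _ ⟨f, hf, rfl⟩
    exact ⟨c • f, Submodule.smul_mem _ c hf,
      (const_smul_mfderiv (hf.1.mdifferentiable (by simp) p) c).symm⟩

/-- Fully regular: the dimension of `𝓘_p` does not vary with `p`. -/
def IsFullyRegular : Prop :=
  ∀ p q : P, Module.finrank ℝ (S.invariantDifferentials p) =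
    Module.finrank ℝ (S.invariantDifferentials q)

/-- `p ∼ q` if some local equivalence maps `p` to `q`. -/
def localEquivSetoid : Setoid P where
  r p q := ∃ Φ, S.IsLocalEquivalence Φ ∧ p ∈ Φ.source ∧ Φ p = q
  iseqv :=
    { refl := fun p => ⟨_, S.isLocalEquivalence_refl, Set.mem_univ p, rfl⟩
      symm := by
        rintro p _ ⟨Φ, h, hp, rfl⟩
        exact ⟨Φ.symm, h.symm, Φ.map_source hp, Φ.left_inv hp⟩
      trans := by
        rintro p _ _ ⟨Φ, h, hp, rfl⟩ ⟨Ψ, h', hp', rfl⟩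
        exact ⟨Φ.trans Ψ, h.trans h', ⟨hp, hp'⟩, rfl⟩ }

/-- The classifying space `X_(θ,ω) = P/∼`. -/
def ClassifyingSpace : Type _ := Quotient S.localEquivSetoid

/-- The classifying map `h : P → X_(θ,ω)`. -/
def classifyingMap (p : P) : S.ClassifyingSpace := Quotient.mk S.localEquivSetoid p

/-- The right `G`-action on `X_(θ,ω)`: `[p] g = [p g]`. -/
instance : MulAction (G)ᵐᵒᵖ S.ClassifyingSpace where
  smul g := Quotient.map (fun p => g • p) (by
    rintro p _ ⟨Φ, h, hp, rfl⟩
    exact ⟨Φ, h, h.source_saturated p hp g.unop, h.equivariant p hp g.unop⟩)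
  one_smul := by
    rintro ⟨p⟩
    exact congrArg S.classifyingMap (one_smul _ p)
  mul_smul := by
    rintro g g' ⟨p⟩
    exact congrArg S.classifyingMap (mul_smul g g' p)

theorem classifyingMap_smul (p : P) (g : G) :
    S.classifyingMap (p <• g) = S.classifyingMap p <• g := rfl

/-- Locally homogeneous: for any two points `m₁, m₂` of `M = P/G` there is a local equivalence
whose induced map on (an open subset of) `M` sends `m₁` to `m₂`. -/
def IsLocallyHomogeneous : Prop :=
  ∀ m₁ m₂ : MulAction.orbitRel.Quotient (G)ᵐᵒᵖ P, ∃ Φ, S.IsLocalEquivalence Φ ∧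
    ∃ p ∈ Φ.source, (Quotient.mk _ p : MulAction.orbitRel.Quotient (G)ᵐᵒᵖ P) = m₁ ∧
      (Quotient.mk _ (Φ p) : MulAction.orbitRel.Quotient (G)ᵐᵒᵖ P) = m₂

end GStructureWithConnection

end GStructures

open scoped RightActions

namespace GStructureWithConnection

section

variable {n : ℕ} {G : ClosedSubgroup (GL (Fin n) ℝ)}
  {E : Type*} [NormedAddCommGroup E] [NormedSpace ℝ E]
  {P : Type*} [TopologicalSpace P] [ChartedSpace E P] [IsManifold 𝓘(ℝ, E) ∞ P]
  [MulAction (G)ᵐᵒᵖ P] (S : GStructureWithConnection G E P)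

/-! Local homogeneity is transitivity of `G` on the classifying space, unwound: both say that for
all `p`, `q` some translate of `p` is carried to `q` by a local equivalence
(`isLocallyHomogeneous_iff`, `isLocallyHomogeneous_iff_isPretransitive`). Full regularity is then a
consequence. The dimension of the space of invariant differentials is unchanged under local
equivalences, which fix every invariant function, and under right translations, which permute the
invariant functions. When these two kinds of maps together connect any two points of `P`, the
dimension is constant. Both invariances come from the pullback inequality
`finrank_invariantDifferentials_le`, applied to a map and to its inverse. -/

/-- If a partial diffeomorphism pulls invariant functions back to germs of invariant functions, then
the differentials of invariant functions span at a point of its source a space of dimension at least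
that at the image point. -/
theorem finrank_invariantDifferentials_le [FiniteDimensional ℝ E]
    (Φ : PartialDiffeomorph 𝓘(ℝ, E) 𝓘(ℝ, E) P P ∞) {p : P} (hp : p ∈ Φ.source)
    (h : ∀ f ∈ S.invariantFunctions, ∃ f' ∈ S.invariantFunctions, f ∘ Φ =ᶠ[𝓝 p] f') :
    Module.finrank ℝ (S.invariantDifferentials (Φ p)) ≤
      Module.finrank ℝ (S.invariantDifferentials p) := by
  have hΦ : MDifferentiableAt 𝓘(ℝ, E) 𝓘(ℝ, E) Φ p := Φ.mdifferentiableAt (by simp) hp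
  have hl : IsLocalDiffeomorphAt 𝓘(ℝ, E) 𝓘(ℝ, E) ∞ Φ p := ⟨Φ, hp, fun _ _ => rfl⟩
  have hsurj : Function.Surjective (mfderiv 𝓘(ℝ, E) 𝓘(ℝ, E) Φ p) := by
    have := (hl.mfderivToContinuousLinearEquiv (by simp)).surjective
    exact this
  -- Tangent spaces at `p` and `Φ p` are both the model space `E`, so pullback of covectors becomes
  -- a linear map of the single dual space of `E`.
  let A : E →L[ℝ] E := mfderiv 𝓘(ℝ, E) 𝓘(ℝ, E) Φ p
  let L : (E →L[ℝ] ℝ) →ₗ[ℝ] (E →L[ℝ] ℝ) :=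
    { toFun := fun l => l.comp A
      map_add' := fun _ _ => rfl
      map_smul' := fun _ _ => rfl }
  have hL : Function.Injective L := by
    intro l l' e
    ext v
    obtain ⟨w, rfl⟩ := hsurj v
    exact congrArg (fun k : E →L[ℝ] ℝ => k w) e
  let V : Submodule ℝ (E →L[ℝ] ℝ) := S.invariantDifferentials (Φ p)
  let W : Submodule ℝ (E →L[ℝ] ℝ) := S.invariantDifferentials p
  have hVW : V.map L ≤ W := by
    -- By the chain rule the pullback of `d f` at `Φ p` is the differential of `f ∘ Φ` at `p`, which
    -- depends only on the germ and so equals that of `f'`.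
    rintro _ ⟨_, ⟨f, hf, rfl⟩, rfl⟩
    obtain ⟨f', hf', e⟩ := h f hf
    exact ⟨f', hf', (mfderiv_comp p (hf.1.mdifferentiable (by simp) _) hΦ).symm.trans
      e.mfderiv_eq⟩
  change Module.finrank ℝ V ≤ Module.finrank ℝ W
  rw [(V.equivMapOfInjective L hL).finrank_eq]
  exact Submodule.finrank_mono hVW

variable {S} in
/-- Local equivalences preserve the dimension of the space of differentials of invariant
functions. -/
theorem IsLocalEquivalence.finrank_invariantDifferentials_eq [FiniteDimensional ℝ E]
    {Φ : PartialDiffeomorph 𝓘(ℝ, E) 𝓘(ℝ, E) P P ∞} (h : S.IsLocalEquivalence Φ) {p : P}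
    (hp : p ∈ Φ.source) :
    Module.finrank ℝ (S.invariantDifferentials (Φ p)) =
      Module.finrank ℝ (S.invariantDifferentials p) := by
  have key {Ψ : PartialDiffeomorph 𝓘(ℝ, E) 𝓘(ℝ, E) P P ∞} (hΨ : S.IsLocalEquivalence Ψ) {q : P}
      (hq : q ∈ Ψ.source) : Module.finrank ℝ (S.invariantDifferentials (Ψ q)) ≤
        Module.finrank ℝ (S.invariantDifferentials q) :=
    S.finrank_invariantDifferentials_le Ψ hq fun f hf =>
      -- Invariance means `f ∘ Ψ = f` on the source, so `f` serves as its own pullback.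
      ⟨f, hf, eventually_of_mem (Ψ.open_source.mem_nhds hq) fun x hx => hf.2 Ψ hΨ x hx⟩
  refine (key h hp).antisymm ?_
  have := key h.symm (Φ.map_source hp)
  rwa [show Φ.symm (Φ p) = p from Φ.left_inv hp] at this

/-- Right translation by an element of the structure group, as a diffeomorphism. -/
def rightTranslation (g : G) : P ≃ₘ^∞⟮𝓘(ℝ, E), 𝓘(ℝ, E)⟯ P where
  toEquiv := MulAction.toPerm (MulOpposite.op g)
  contMDiff_toFun := S.contMDiff_smul g
  contMDiff_invFun := S.contMDiff_smul g⁻¹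

/-- Right translates of invariant functions are invariant. -/
theorem invariantFunctions_comp_smul {f : P → ℝ} (hf : f ∈ S.invariantFunctions) (g : G) :
    (fun p : P => f (p <• g)) ∈ S.invariantFunctions := by
  refine ⟨hf.1.comp (S.contMDiff_smul g), fun Φ hΦ p hp => ?_⟩
  change f (Φ p <• g) = f (p <• g)
  rw [← hΦ.equivariant p hp g]
  exact hf.2 Φ hΦ _ (hΦ.source_saturated p hp g)

/-- The dimension of the space of differentials of invariant functions is constant along
`G`-orbits. -/
theorem finrank_invariantDifferentials_smul [FiniteDimensional ℝ E] (p : P) (g : G) :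
    Module.finrank ℝ (S.invariantDifferentials (p <• g)) =
      Module.finrank ℝ (S.invariantDifferentials p) := by
  have key (q : P) (k : G) : Module.finrank ℝ (S.invariantDifferentials (q <• k)) ≤
      Module.finrank ℝ (S.invariantDifferentials q) :=
    -- Translation by `k` multiplies `θ` by `k⁻¹`, so it need not be a local equivalence and `f`
    -- need not be fixed; its pullback is the translated function, again invariant.
    S.finrank_invariantDifferentials_le (S.rightTranslation k).toPartialDiffeomorph
      (Set.mem_univ q) fun f hf => ⟨_, S.invariantFunctions_comp_smul hf k, EventuallyEq.rfl⟩
  refine (key p g).antisymm ?_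
  have := key (p <• g) g⁻¹
  rwa [show (p <• g) <• g⁻¹ = p from inv_smul_smul (MulOpposite.op g) p] at this

/-- Local homogeneity, expressed on `P` rather than on the orbit space `P/G`. -/
theorem isLocallyHomogeneous_iff : S.IsLocallyHomogeneous ↔
    ∀ p q : P, ∃ Φ, S.IsLocalEquivalence Φ ∧ ∃ g : G, p <• g ∈ Φ.source ∧ Φ (p <• g) = q := by
  constructor
  · intro h p q
    obtain ⟨Φ, hΦ, r, hr, hrp, hrq⟩ := h (Quotient.mk _ p) (Quotient.mk _ q)
    obtain ⟨a, rfl⟩ := MulAction.orbitRel_apply.mp (Quotient.exact hrp)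
    obtain ⟨b, hb⟩ := MulAction.orbitRel_apply.mp (Quotient.exact hrq.symm)
    -- Here `a` moves `p` to the chosen source point and `b` moves its image to `q`. Equivariance
    -- lets `b` be applied before `Φ` instead of after it; passing to the opposite group reverses
    -- the product, so `a` acts first.
    refine ⟨Φ, hΦ, a.unop * b.unop, ?_, ?_⟩
    · rw [MulOpposite.op_mul, mul_smul]
      exact hΦ.source_saturated _ hr b.unop
    · rw [MulOpposite.op_mul, mul_smul]
      exact (hΦ.equivariant _ hr b.unop).trans hb
  · rintro h ⟨p⟩ ⟨q⟩
    obtain ⟨Φ, hΦ, g, hg, rfl⟩ := h p q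
    exact ⟨Φ, hΦ, _, hg, Quotient.sound (MulAction.orbitRel_apply.mpr ⟨MulOpposite.op g, rfl⟩), rfl⟩

/-- Local homogeneity is transitivity of the `G`-action on the classifying space. -/
theorem isLocallyHomogeneous_iff_isPretransitive : S.IsLocallyHomogeneous ↔
    MulAction.IsPretransitive (G)ᵐᵒᵖ S.ClassifyingSpace := by
  rw [isLocallyHomogeneous_iff]
  constructor
  · refine fun h => ⟨?_⟩
    rintro ⟨p⟩ ⟨q⟩
    obtain ⟨Φ, hΦ, g, hg, e⟩ := h p q
    -- The class `[p] g` is by definition `[p g]`, so equality with `[q]` is exactly a local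
    -- equivalence from `p g` to `q`.
    exact ⟨MulOpposite.op g, Quotient.sound (s := S.localEquivSetoid) ⟨Φ, hΦ, hg, e⟩⟩
  · intro h p q
    obtain ⟨g, hg⟩ := h.exists_smul_eq (S.classifyingMap p) (S.classifyingMap q)
    obtain ⟨Φ, hΦ, hs, e⟩ := Quotient.exact (s := S.localEquivSetoid) hg
    exact ⟨Φ, hΦ, g.unop, hs, e⟩

variable {S} in
/-- A locally homogeneous `G`-structure with connection is fully regular. -/
theorem IsLocallyHomogeneous.isFullyRegular [FiniteDimensional ℝ E]
    (h : S.IsLocallyHomogeneous) : S.IsFullyRegular := by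
  intro p q
  obtain ⟨Φ, hΦ, g, hg, rfl⟩ := S.isLocallyHomogeneous_iff.mp h p q
  -- The dimension is carried from `Φ (p g)` back to `p g` by the local equivalence, then to `p` by
  -- translation.
  rw [hΦ.finrank_invariantDifferentials_eq hg, S.finrank_invariantDifferentials_smul]

end

end GStructureWithConnection

theorem mainTheorem4 {n : ℕ} (G : ClosedSubgroup (GL (Fin n) ℝ))
    {E : Type*} [NormedAddCommGroup E] [NormedSpace ℝ E] [FiniteDimensional ℝ E]
    {P : Type*} [TopologicalSpace P] [T2Space P] [SecondCountableTopology P]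
    [ChartedSpace E P] [IsManifold 𝓘(ℝ, E) ∞ P] [MulAction (G)ᵐᵒᵖ P]
    (S : GStructureWithConnection G E P) :
    S.IsLocallyHomogeneous ↔
      S.IsFullyRegular ∧ MulAction.IsPretransitive (G)ᵐᵒᵖ S.ClassifyingSpace :=
  ⟨fun h => ⟨h.isFullyRegular, S.isLocallyHomogeneous_iff_isPretransitive.mp h⟩,
    fun h => S.isLocallyHomogeneous_iff_isPretransitive.mpr h.2⟩
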